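/- Consider a periodic-review inventory system with lead time $\tau\in\mathbb{N}_0$, holding cost $h>0$, shortage cost $p>0$ and i.i.d. non-negative demands $D_0,D_1,\dots$ with finite mean $\mu$. In period $t$ an order $q_{t+\tau}\ge 0$ is placed, as a (measurable) function of $t$ and of the state $\mathbf{x}_t=(I_t,q_{t+1},\dots,q_{t+\tau-1})$; it arrives at the start of period $t+\tau$ (for $\tau=0$ it arrives at once and the state is the inventory left over from the previous period). In the lost-sales system $\mathcal{L}$ the inventory level satisfies $I_t=(I_{t-1}-D_{t-1})^++q_t$; in the back-order system $\mathcal{B}$ it satisfies $I^{\mathcal{B}}_t=I^{\mathcal{B}}_{t-1}-D_{t-1}+q_t$. Both start empty (no inventory before period $0$, and $q_t=0$ for $t<\tau$). Period $t$ costs $c_t=h(I_t-D_t)^++p(D_t-I_t)^+$ in $\mathcal{L}$, and $c^{\mathcal{B}}_t$ is the same expression with $I_t^{\mathcal{B}}$. The cost rate of a policy $\mathrm{A}$ is $$C(\mathrm{A})=\limsup_{T\to\infty}\mathbb{E}\Big[\frac{1}{T-\tau+1}\sum_{t=\tau}^{T}c_t\Big]$$ in $\mathcal{L}$, and $C^{\mathcal{B}}(\mathrm{A})$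 is defined likewise in $\mathcal{B}$; $C^*$ and $C^{\mathcal{B}*}$ are the infima of $C$ and $C^{\mathcal{B}}$ over all policies. The projected inventory level (PIL) policy $\mathrm{P}^U$ orders $(U-\mathbb{E}[Z_{t+\tau}\mid\mathbf{x}_t])^+$ in period $t$, where $Z_{t+\tau}$ is the inventory at the start of period $t+\tau$ before $q_{t+\tau}$ is received, namely $(I_{t+\tau-1}-D_{t+\tau-1})^+$ in $\mathcal{L}$ and $I^{\mathcal{B}}_{t+\tau-1}-D_{t+\tau-1}$ in $\mathcal{B}$. The base-stock policy $\mathrm{B}^S$ orders $(S-I_t-q_{t+1}-\dots-q_{t+\tau-1})^+$ (for $\tau=0$: $S$ minus the inventory left over from the previous period, positive part). Write $D[0,\tau]=D_0+\dots+D_\tau$ and let $$S^*=\inf\Big\{S:\ \mathbb{P}(D[0,\tau]\le S)\ge \frac{p}{p+h}\Big\}.$$ Theorem. In $\mathcal{B}$ the policies $\mathrm{B}^{S^*}$ and $\mathrm{P}^{S^*-\tau\mu}$ coincide and are optimal: $$C^{\mathcal{B}}(\mathrm{B}^{S^*})=C^{\mathcal{B}}(\mathrm{P}^{S^*-\tau\mu})=C^{\mathcal{B}*}=h\,\mathbb{E}\big[(S^*-D[0,\tau])^+\big]+p\,\mathbb{E}\big[(D[0,\tau]-S^*)^+\big].$$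 In $\mathcal{L}$, $$C^*\le C\big(\mathrm{P}^{(S^*-\tau\mu)^+}\big)\le C^{\mathcal{B}*},$$ and for every $U^*\in\operatorname{argmin}_{U\ge0}C(\mathrm{P}^U)$, $$C^*\le C(\mathrm{P}^{U^*})\le C\big(\mathrm{P}^{(S^*-\tau\mu)^+}\big)\le C^{\mathcal{B}*}.$$ In particular $C^*\le C^{\mathcal{B}*}$. -/

import Mathlib

open MeasureTheory ProbabilityTheory Filter

namespace Inventory

noncomputable section

/-- The two systems compared: excess demand is lost, or it is back-ordered. -/
inductive Kind
  | lostSales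
  | backOrder

/-- What is left of the net inventory `z = I - d` at the end of a period: `z⁺` with lost sales,
`z` itself (possibly negative) with back-orders. -/
def Kind.carry : Kind → ℝ → ℝ
  | .lostSales, z => max z 0
  | .backOrder, z => z

/-- The state `(I_t, q_{t+1}, …, q_{t+τ-1})` on which the order of period `t` is based.
For `τ ≥ 1` the first entry is the inventory level `I_t` of period `t` (the order placed `τ` periods
ago has been received) and the second lists the `τ - 1` outstanding orders, the earliest first.
For `τ = 0` an order arrives at once, and the first entry is the inventory carried over from
the previous period, before the order of period `t` is placed. -/
abbrev State (τ : ℕ) : Type := ℝ × (Fin (τ - 1) → ℝ)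

/-- A policy: the order placed in period `t` as a function of the state. -/
abbrev Policy (τ : ℕ) : Type := ℕ → State τ → ℝ

/-- Orders are non-negative and depend measurably on the state. -/
def Policy.Admissible {τ : ℕ} (A : Policy τ) : Prop :=
  ∀ t, Measurable (A t) ∧ ∀ x, 0 ≤ A t x

/-- The inventory level `I_t` from which the demand of the period is met,
given the state `x` and the order `a` placed in that period. -/
def level : (τ : ℕ) → State τ → ℝ → ℝ
  | 0, x, a => x.1 + a
  | _ + 1, x, _ => x.1

/-- The next state, given the state `x`, the order `a` and the demand `d` of the period. -/
def nextState (k : Kind) : (τ : ℕ) → State τ → ℝ → ℝ → State τ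
  | 0, x, a, d => (k.carry (x.1 + a - d), x.2)
  | n + 1, x, a, d =>
    -- the outstanding orders `q_{t+1}, …, q_{t+τ}` after the order `a = q_{t+τ}` was placed
    let q : Fin (n + 1) → ℝ := Fin.snoc (α := fun _ => ℝ) x.2 a
    (k.carry (x.1 - d) + q 0, Fin.tail q)

/-- The state at time `t` when policy `A` is used on the demands `d 0, d 1, …` from state `x`. -/
def stateFrom (k : Kind) {τ : ℕ} (A : Policy τ) (d : ℕ → ℝ) (x : State τ) : ℕ → State τ
  | 0 => x
  | t + 1 => nextState k τ (stateFrom k A d x t) (A t (stateFrom k A d x t)) (d t)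

/-- The inventory level `I_t` under policy `A`, from the zero initial state. -/
def inventoryLevel (k : Kind) {τ : ℕ} (A : Policy τ) (d : ℕ → ℝ) (t : ℕ) : ℝ :=
  level τ (stateFrom k A d 0 t) (A t (stateFrom k A d 0 t))

/-- The cost of period `t`: `h` per item left over and `p` per item short
(lost or back-ordered, according to the system). -/
def periodCost (k : Kind) {τ : ℕ} (h p : ℝ) (A : Policy τ) (d : ℕ → ℝ) (t : ℕ) : ℝ :=
  h * max (inventoryLevel k A d t - d t) 0 + p * max (d t - inventoryLevel k A d t) 0

section Stochastic

variable {Ω : Type*} [MeasurableSpace Ω]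

/-- The cost-rate `limsup_{T → ∞} E[(T - τ + 1)⁻¹ ∑_{t=τ}^{T} c_t]` of a policy, a value in
`[0, ∞]`. -/
def costRate (P : Measure Ω) (D : ℕ → Ω → ℝ) (k : Kind) {τ : ℕ} (h p : ℝ) (A : Policy τ) :
    ENNReal :=
  limsup (fun T : ℕ => ∫⁻ ω, ENNReal.ofReal
    (1 / ((T : ℝ) - τ + 1) * ∑ t ∈ Finset.Icc τ T, periodCost k h p A (fun i => D i ω) t) ∂P) atTop

/-- The optimal cost-rate of a system with lead time `τ`. -/
def optimalCostRate (P : Measure Ω) (D : ℕ → Ω → ℝ) (k : Kind) (τ : ℕ) (h p : ℝ) : ENNReal :=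
  ⨅ (A : Policy τ) (_ : A.Admissible), costRate P D k h p A

/-- The projected inventory: given state `x` at time `t`, the expectation over the demands
`D_t, …, D_{t+τ-1}` of the inventory at the start of period `t + τ` without the order placed
in period `t`. It does not depend on orders placed from period `t` on, as these arrive no earlier
than period `t + τ`; they are set to zero. -/
def projectedInventory (P : Measure Ω) (D : ℕ → Ω → ℝ) (k : Kind) (τ t : ℕ) (x : State τ) : ℝ :=
  ∫ ω, (stateFrom k (fun _ _ => 0) (fun i => D (t + i) ω) x τ).1 ∂P

/-- The projected inventory level policy with level `U`. -/
def pilPolicy (P : Measure Ω) (D : ℕ → Ω → ℝ) (k : Kind) (τ : ℕ) (U : ℝ) : Policy τ :=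
  fun t x => max (U - projectedInventory P D k τ t x) 0

/-- The base-stock policy with base-stock level `S`. -/
def baseStockPolicy (τ : ℕ) (S : ℝ) : Policy τ :=
  fun _ x => max (S - (x.1 + ∑ j, x.2 j)) 0

/-- The lead time demand `D[0, τ] = D_0 + … + D_τ`. -/
def leadTimeDemand (D : ℕ → Ω → ℝ) (τ : ℕ) (ω : Ω) : ℝ :=
  ∑ i ∈ Finset.range (τ + 1), D i ω

/-- The newsvendor base-stock level `inf {S : ℙ(D[0, τ] ≤ S) ≥ p / (p + h)}`. -/
def newsvendorLevel (P : Measure Ω) (D : ℕ → Ω → ℝ) (τ : ℕ) (h p : ℝ) : ℝ :=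
  sInf {S : ℝ | p / (p + h) ≤ P.real {ω | leadTimeDemand D τ ω ≤ S}}

/-- The newsvendor cost `h E[(S - D[0, τ])⁺] + p E[(D[0, τ] - S)⁺]`. -/
def newsvendorCost (P : Measure Ω) (D : ℕ → Ω → ℝ) (τ : ℕ) (h p S : ℝ) : ℝ :=
  h * ∫ ω, max (S - leadTimeDemand D τ ω) 0 ∂P + p * ∫ ω, max (leadTimeDemand D τ ω - S) 0 ∂P

end Stochastic

end

end Inventory

open Inventory

/-! An order placed in period `t` takes effect `τ` periods later. The cost of period `t + τ` is
therefore found by conditioning on the state and order of period `t`, which are independent of the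
demands from period `t` on. Put `G y = E[netCost (y - D[0,τ])]`, which is `positionCost`.

With back-orders nothing is truncated, and the conditional cost is `G` of the inventory position
after ordering. `G` is minimal at the newsvendor level `S` (`positionCost_newsvendorLevel_le`), so
`G S` bounds the cost of every policy in every such period from below. The base-stock policy keeps
the position at `S` and attains it. Projected inventory is position minus `τ μ`, so the PIL policy
is the same policy.

With lost sales the projected inventory never exceeds `U` along a PIL trajectory
(`stateFrom_pilPolicy`), so given the state the level `τ` periods ahead has mean exactly `U`. Its
expected cost is at most `G (U + τ μ)` (`integral_netCost_levelAfter_le`): as a function of one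
demand the level falls at rate at most one, while the back-order level falls at rate exactly one. At
equal means the former is smaller in convex order (`integral_comp_le_of_antitone`), and independence
lets the demands be treated one at a time. The choice `U = S - τ μ` gives `G S`. If `S < τ μ`, then
`U = 0`, the level vanishes almost surely, and the cost `p μ` is at most `p ((τ + 1) μ - S) ≤ G S`.
-/

namespace Inventory

/-! ### Inventory levels over the lead time and the one-period cost -/

/-- The inventory level after `n` periods, starting from the level `y`, when the order `q i`
arrives at the start of period `i + 1`. -/
def levelAfter (k : Kind) (q d : ℕ → ℝ) (y : ℝ) : ℕ → ℝ
  | 0 => y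
  | n + 1 => k.carry (levelAfter k q d y n - d n) + q n

/-- The orders outstanding in state `x` once the order `a` has been placed. -/
def pipeline {τ : ℕ} (x : State τ) (a : ℝ) (n : ℕ) : ℝ :=
  if hn : n < τ - 1 then x.2 ⟨n, hn⟩ else a

/-- The inventory level `τ` periods ahead, when the order `a` has just been placed. -/
def leadLevel (k : Kind) {τ : ℕ} (x : State τ) (a : ℝ) (d : ℕ → ℝ) : ℝ :=
  levelAfter k (pipeline x a) d (level τ x a) τ

/-- The cost of a period that ends with net inventory `z`. -/
def netCost (h p z : ℝ) : ℝ := h * max z 0 + p * max (-z) 0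

lemma periodCost_eq_netCost (k : Kind) {τ : ℕ} (h p : ℝ) (A : Policy τ) (d : ℕ → ℝ) (t : ℕ) :
    periodCost k h p A d t = netCost h p (inventoryLevel k A d t - d t) := by
  simp [periodCost, netCost]

lemma netCost_nonneg {h p : ℝ} (hh : 0 < h) (hp : 0 < p) (z : ℝ) : 0 ≤ netCost h p z := by
  unfold netCost; positivity

lemma neg_mul_le_netCost {h p : ℝ} (hh : 0 < h) (hp : 0 < p) (z : ℝ) : -p * z ≤ netCost h p z := by
  unfold netCost
  rcases le_total z 0 with hz | hz
  · rw [max_eq_right hz, max_eq_left (by linarith)]; linarith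
  · rw [max_eq_left hz, max_eq_right (by linarith)]; nlinarith [mul_nonneg hh.le hz, mul_nonneg hp.le hz]

lemma abs_netCost_sub_le {h p : ℝ} (hh : 0 < h) (hp : 0 < p) (y z : ℝ) :
    |netCost h p y - netCost h p z| ≤ (h + p) * |y - z| := by
  have h1 : |max y 0 - max z 0| ≤ |y - z| := abs_max_sub_max_le_abs y z 0
  have h2 : |max (-y) 0 - max (-z) 0| ≤ |y - z| := by
    have := abs_max_sub_max_le_abs (-y) (-z) 0
    rwa [show -y - -z = -(y - z) by ring, abs_neg] at this
  calc |netCost h p y - netCost h p z|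
      = |h * (max y 0 - max z 0) + p * (max (-y) 0 - max (-z) 0)| := by
        unfold netCost; congr 1; ring
    _ ≤ h * |max y 0 - max z 0| + p * |max (-y) 0 - max (-z) 0| := by
        refine (abs_add_le _ _).trans ?_
        rw [abs_mul, abs_mul, abs_of_pos hh, abs_of_pos hp]
    _ ≤ (h + p) * |y - z| := by nlinarith

lemma continuous_netCost (h p : ℝ) : Continuous (netCost h p) := by
  unfold netCost; fun_prop

lemma convexOn_netCost {h p : ℝ} (hh : 0 < h) (hp : 0 < p) :
    ConvexOn ℝ Set.univ (netCost h p) := by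
  have h1 : ConvexOn ℝ Set.univ (fun z : ℝ => max z 0) :=
    (convexOn_id convex_univ).sup (convexOn_const 0 convex_univ)
  have h2 : ConvexOn ℝ Set.univ (fun z : ℝ => max (-z) 0) :=
    (concaveOn_id convex_univ).neg.sup (convexOn_const 0 convex_univ)
  exact (h1.smul hh.le).add (h2.smul hp.le)

/-! ### The level recursion: monotonicity, Lipschitz bounds, splitting in time -/

lemma continuous_carry (k : Kind) : Continuous k.carry := by
  cases k
  · exact continuous_id.max continuous_const
  · exact continuous_id

lemma monotone_carry (k : Kind) : Monotone k.carry := by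
  cases k
  · exact fun x y hxy => max_le_max hxy le_rfl
  · exact fun x y hxy => hxy

lemma carry_sub_carry_le (k : Kind) {y z : ℝ} (hyz : y ≤ z) : k.carry z - k.carry y ≤ z - y := by
  cases k
  · simp only [Kind.carry]
    rcases le_total y 0 with hy | hy <;> rcases le_total z 0 with hz | hz <;>
      simp only [max_eq_left, max_eq_right, hy, hz] <;> linarith
  · exact le_rfl

lemma abs_carry_le (k : Kind) (z : ℝ) : |k.carry z| ≤ |z| := by
  cases k
  · simp only [Kind.carry]
    rcases le_total z 0 with hz | hz
    · simp [hz]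
    · simp [hz]
  · exact le_rfl

/-- The recursion peels off the last period; conditioning on the first demand requires peeling off
the first. -/
lemma levelAfter_succ' (k : Kind) (q d : ℕ → ℝ) (y : ℝ) (n : ℕ) :
    levelAfter k q d y (n + 1) = levelAfter k (fun i => q (i + 1)) (fun i => d (i + 1))
      (k.carry (y - d 0) + q 0) n := by
  induction n with
  | zero => rfl
  | succ n ih => rw [levelAfter, ih]; rfl

lemma levelAfter_congr (k : Kind) {q q' d d' : ℕ → ℝ} (y : ℝ) (n : ℕ)
    (hq : ∀ i < n, q i = q' i) (hd : ∀ i < n, d i = d' i) :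
    levelAfter k q d y n = levelAfter k q' d' y n := by
  induction n with
  | zero => rfl
  | succ n ih =>
    rw [levelAfter, levelAfter, ih (fun i hi => hq i (by omega)) (fun i hi => hd i (by omega)),
      hq n (by omega), hd n (by omega)]

lemma levelAfter_add (k : Kind) (q d : ℕ → ℝ) (y : ℝ) (t n : ℕ) :
    levelAfter k q d y (t + n) =
      levelAfter k (fun i => q (t + i)) (fun i => d (t + i)) (levelAfter k q d y t) n := by
  induction n with
  | zero => rfl
  | succ n ih => rw [← add_assoc, levelAfter, ih]; rfl

lemma monotone_levelAfter (k : Kind) (q d : ℕ → ℝ) (n : ℕ) :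
    Monotone (fun y => levelAfter k q d y n) := by
  induction n with
  | zero => exact monotone_id
  | succ n ih =>
    intro y z hyz
    have := monotone_carry k (sub_le_sub_right (ih hyz) (d n))
    simpa [levelAfter] using this

lemma levelAfter_sub_le (k : Kind) (q d : ℕ → ℝ) (n : ℕ) {y z : ℝ} (hyz : y ≤ z) :
    levelAfter k q d z n - levelAfter k q d y n ≤ z - y := by
  induction n with
  | zero => exact le_rfl
  | succ n ih =>
    have h1 : levelAfter k q d y n - d n ≤ levelAfter k q d z n - d n :=
      sub_le_sub_right (monotone_levelAfter k q d n hyz) _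
    have := carry_sub_carry_le k h1
    simp only [levelAfter]
    linarith

lemma abs_levelAfter_le (k : Kind) (q d : ℕ → ℝ) (y : ℝ) (n : ℕ) :
    |levelAfter k q d y n| ≤ |y| + ∑ i ∈ Finset.range n, (|d i| + |q i|) := by
  induction n with
  | zero => simp [levelAfter]
  | succ n ih =>
    rw [levelAfter, Finset.sum_range_succ]
    have h1 := abs_carry_le k (levelAfter k q d y n - d n)
    have h2 := abs_sub (levelAfter k q d y n) (d n)
    have h3 := abs_add_le (k.carry (levelAfter k q d y n - d n)) (q n)
    linarith

lemma levelAfter_backOrder (q d : ℕ → ℝ) (y : ℝ) (n : ℕ) :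
    levelAfter .backOrder q d y n =
      y + ∑ i ∈ Finset.range n, q i - ∑ i ∈ Finset.range n, d i := by
  induction n with
  | zero => simp [levelAfter]
  | succ n ih =>
    rw [levelAfter, ih, Finset.sum_range_succ, Finset.sum_range_succ]
    simp only [Kind.carry]; ring

lemma levelAfter_nonneg {q d : ℕ → ℝ} {y : ℝ} (hy : 0 ≤ y) (n : ℕ) (hq : ∀ i < n, 0 ≤ q i) :
    0 ≤ levelAfter .lostSales q d y n := by
  cases n with
  | zero => exact hy
  | succ n => exact add_nonneg (le_max_right _ _) (hq n (by omega))

/-! ### From states and policies to levels a lead time ahead -/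

/-- The order arrives last, after every truncation within the lead time. -/
lemma leadLevel_eq_add (k : Kind) {τ : ℕ} (x : State τ) (a : ℝ) (d : ℕ → ℝ) :
    leadLevel k x a d = leadLevel k x 0 d + a := by
  cases τ with
  | zero => simp [leadLevel, levelAfter, level]
  | succ m =>
    simp only [leadLevel, levelAfter, level]
    rw [levelAfter_congr k (q := pipeline x a) (q' := pipeline x 0) (d' := d) x.1 m
      (fun i hi => by simp [pipeline, hi]) (fun _ _ => rfl)]
    simp [pipeline]

lemma nextState_fst (k : Kind) {m : ℕ} (x : State (m + 1)) (a d : ℝ) :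
    (nextState k (m + 1) x a d).1 = k.carry (x.1 - d) + pipeline x a 0 := by
  simp only [nextState, pipeline, Fin.snoc]
  congr 1

lemma nextState_snd (k : Kind) {m : ℕ} (x : State (m + 1)) (a d : ℝ) (j : Fin m) :
    (nextState k (m + 1) x a d).2 j = pipeline x a (j + 1) := by
  simp only [nextState, pipeline, Fin.tail, Fin.snoc]
  congr 1

/-- With a positive lead time, the state lists the level and the orders outstanding; `q` are the
orders outstanding at time `0`, followed by those that the policy places. -/
lemma stateFrom_succ_lead (k : Kind) {m : ℕ} (A : Policy (m + 1)) (d : ℕ → ℝ) (x : State (m + 1))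
    (q : ℕ → ℝ) (hq : ∀ n, q n = if hn : n < m then x.2 ⟨n, hn⟩ else
      A (n - m) (stateFrom k A d x (n - m))) (t : ℕ) :
    (stateFrom k A d x t).1 = levelAfter k q d x.1 t ∧
      ∀ j : Fin m, (stateFrom k A d x t).2 j = q (t + j) := by
  induction t with
  | zero =>
    refine ⟨rfl, fun j => ?_⟩
    rw [hq]; simp [stateFrom]
  | succ t ih =>
    have key : ∀ n ≤ m, pipeline (stateFrom k A d x t) (A t (stateFrom k A d x t)) n
        = q (t + n) := by
      intro n hn
      by_cases hnm : n < m
      · have := ih.2 ⟨n, hnm⟩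
        simpa [pipeline, hnm] using this
      · obtain rfl : n = m := by omega
        rw [hq]
        simp [pipeline]
    refine ⟨?_, fun j => ?_⟩
    · rw [stateFrom, nextState_fst, key 0 (Nat.zero_le _), ih.1]; rfl
    · rw [stateFrom, nextState_snd, key (j + 1) (by omega)]
      congr 1; omega

/-- This separates the past, which enters through the state and order of period `t`, from the later
demands. -/
lemma inventoryLevel_eq_leadLevel (k : Kind) {τ : ℕ} (A : Policy τ) (d : ℕ → ℝ) (t : ℕ) :
    inventoryLevel k A d (t + τ) =
      leadLevel k (stateFrom k A d 0 t) (A t (stateFrom k A d 0 t)) (fun i => d (t + i)) := by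
  cases τ with
  | zero => rfl
  | succ m =>
    set q : ℕ → ℝ := fun n => if hn : n < m then (0 : State (m + 1)).2 ⟨n, hn⟩ else
      A (n - m) (stateFrom k A d 0 (n - m)) with hq
    have hs := stateFrom_succ_lead k A d 0 q (fun n => rfl)
    change (stateFrom k A d 0 (t + (m + 1))).1 = _
    rw [(hs _).1, levelAfter_add]
    simp only [leadLevel, level]
    rw [(hs t).1]
    refine levelAfter_congr k _ _ (fun i hi => ?_) (fun _ _ => rfl)
    by_cases him : i < m
    · have := (hs t).2 ⟨i, him⟩
      simpa [pipeline, him] using this.symm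
    · obtain rfl : i = m := by omega
      simp [pipeline, hq]

lemma stateFrom_zero_orders (k : Kind) {τ : ℕ} (d : ℕ → ℝ) (x : State τ) :
    (stateFrom k (fun _ _ => 0) d x τ).1 = leadLevel k x 0 d := by
  cases τ with
  | zero => simp [stateFrom, leadLevel, levelAfter, level]
  | succ m => exact (stateFrom_succ_lead k _ d x (pipeline x 0) (fun n => rfl) (m + 1)).1

/-- Both trajectories face the demands `e`. The one from the next state has met the extra demand
`d₀` and receives each outstanding order one period earlier, so it is ahead by at most the next
order due. At the end of the lead time the other trajectory has received that order too, and the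
advantage is gone. -/
lemma leadLevel_nextState_le {τ : ℕ} {x : State τ} {a d₀ : ℝ} (hy : 0 ≤ level τ x a)
    (hq : ∀ i, 0 ≤ pipeline x a i) (hd : 0 ≤ d₀) (e : ℕ → ℝ) :
    leadLevel .lostSales (nextState .lostSales τ x a d₀) 0 e ≤ leadLevel .lostSales x a e := by
  cases τ with
  | zero =>
    simp only [level] at hy
    simp only [leadLevel, levelAfter, nextState, level, Kind.carry]
    exact (add_zero _).trans_le (max_le (by linarith) hy)
  | succ m =>
    set x' := nextState .lostSales (m + 1) x a d₀ with hx'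
    simp only [level] at hy
    simp only [leadLevel, level]
    have h0 : x'.1 ≤ x.1 + pipeline x a 0 := by
      rw [hx', nextState_fst]
      simp only [Kind.carry]
      have : max (x.1 - d₀) 0 ≤ x.1 := max_le (by linarith) hy
      linarith
    have aux : ∀ u v e r : ℝ, u ≤ v + r → 0 ≤ r → max (u - e) 0 ≤ max (v - e) 0 + r := by
      intro u v e r hu hr
      have h1 := le_max_left (v - e) 0
      have h2 := le_max_right (v - e) 0
      exact max_le (by linarith) (by linarith)
    have key : ∀ j ≤ m, levelAfter .lostSales (pipeline x' 0) e x'.1 j ≤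
        levelAfter .lostSales (pipeline x a) e x.1 j + pipeline x a j := by
      intro j
      induction j with
      | zero => exact fun _ => h0
      | succ j ih =>
        intro hj
        have h2 : pipeline x' 0 j = pipeline x a (j + 1) := by
          rw [pipeline, dif_pos (by omega : j < m + 1 - 1), hx', nextState_snd]
        rw [levelAfter, levelAfter, h2]
        have := aux _ _ (e j) _ (ih (by omega)) (hq j)
        simp only [Kind.carry]
        linarith
    have h3 : pipeline x' 0 m = 0 := by simp [pipeline]
    rw [levelAfter, levelAfter, h3]
    have := aux _ _ (e m) _ (key m le_rfl) (hq m)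
    simp only [Kind.carry]
    linarith

/-! ### Inventory position, signs and measurability -/

/-- On hand, or short, plus on order. -/
def inventoryPosition {τ : ℕ} (x : State τ) : ℝ := x.1 + ∑ j, x.2 j

lemma level_add_sum_pipeline {τ : ℕ} (x : State τ) (a : ℝ) :
    level τ x a + ∑ i ∈ Finset.range τ, pipeline x a i = inventoryPosition x + a := by
  cases τ with
  | zero => simp [level, inventoryPosition]
  | succ m =>
    rw [Finset.sum_range_succ, Finset.sum_range]
    simp [level, inventoryPosition, pipeline, add_assoc]

lemma leadLevel_backOrder {τ : ℕ} (x : State τ) (a : ℝ) (d : ℕ → ℝ) :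
    leadLevel .backOrder x a d = inventoryPosition x + a - ∑ i ∈ Finset.range τ, d i := by
  rw [leadLevel, levelAfter_backOrder, level_add_sum_pipeline]

lemma inventoryPosition_nextState {τ : ℕ} (x : State τ) (a d : ℝ) :
    inventoryPosition (nextState .backOrder τ x a d) = inventoryPosition x + a - d := by
  cases τ with
  | zero => simp [inventoryPosition, nextState, Kind.carry]
  | succ m =>
    have h1 := level_add_sum_pipeline x a
    rw [Finset.sum_range_succ', Finset.sum_range] at h1
    simp only [level] at h1
    rw [inventoryPosition, nextState_fst]
    simp_rw [nextState_snd]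
    change x.1 - d + pipeline x a 0 + ∑ j : Fin m, pipeline x a (j + 1) = _
    linarith

lemma stateFrom_congr (k : Kind) {τ : ℕ} (A : Policy τ) {d d' : ℕ → ℝ} (x : State τ) (t : ℕ)
    (hd : ∀ i < t, d i = d' i) : stateFrom k A d x t = stateFrom k A d' x t := by
  induction t with
  | zero => rfl
  | succ t ih =>
    rw [stateFrom, stateFrom, ih (fun i hi => hd i (by omega)), hd t (by omega)]

lemma pipeline_nonneg {τ : ℕ} {x : State τ} {a : ℝ} (hx : ∀ j, 0 ≤ x.2 j) (ha : 0 ≤ a) (i : ℕ) :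
    0 ≤ pipeline x a i := by
  rw [pipeline]; split_ifs
  exacts [hx _, ha]

lemma level_nonneg {τ : ℕ} {x : State τ} {a : ℝ} (hx : 0 ≤ x.1) (ha : 0 ≤ a) :
    0 ≤ level τ x a := by
  cases τ
  exacts [add_nonneg hx ha, hx]

lemma nextState_lostSales_nonneg {τ : ℕ} {x : State τ} {a d : ℝ} (hx : ∀ j, 0 ≤ x.2 j)
    (ha : 0 ≤ a) : 0 ≤ (nextState .lostSales τ x a d).1 ∧
      ∀ j, 0 ≤ (nextState .lostSales τ x a d).2 j := by
  cases τ with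
  | zero => exact ⟨le_max_right _ _, hx⟩
  | succ m =>
    refine ⟨?_, fun j => ?_⟩
    · rw [nextState_fst]
      exact add_nonneg (le_max_right _ _) (pipeline_nonneg hx ha 0)
    · rw [nextState_snd]; exact pipeline_nonneg hx ha _

lemma measurable_levelAfter {α : Type*} [MeasurableSpace α] (k : Kind) (n : ℕ)
    {q d : α → ℕ → ℝ} {y : α → ℝ} (hq : Measurable q) (hd : Measurable d) (hy : Measurable y) :
    Measurable (fun z => levelAfter k (q z) (d z) (y z) n) := by
  induction n with
  | zero => exact hy
  | succ n ih =>
    exact ((continuous_carry k).measurable.comp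
      (ih.sub ((measurable_pi_apply n).comp hd))).add ((measurable_pi_apply n).comp hq)

lemma measurable_leadLevel {α : Type*} [MeasurableSpace α] (k : Kind) {τ : ℕ}
    {x : α → State τ} {a : α → ℝ} {d : α → ℕ → ℝ} (hx : Measurable x) (ha : Measurable a)
    (hd : Measurable d) : Measurable (fun z => leadLevel k (x z) (a z) (d z)) := by
  refine measurable_levelAfter k τ ?_ hd ?_
  · refine measurable_pi_lambda _ fun n => ?_
    unfold pipeline
    split_ifs
    · exact (measurable_pi_apply _).comp (measurable_snd.comp hx)
    · exact ha
  · cases τ with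
    | zero => exact (measurable_fst.comp hx).add ha
    | succ m => exact measurable_fst.comp hx

lemma measurable_nextState {α : Type*} [MeasurableSpace α] (k : Kind) {τ : ℕ}
    {x : α → State τ} {a d : α → ℝ} (hx : Measurable x) (ha : Measurable a)
    (hd : Measurable d) : Measurable (fun z => nextState k τ (x z) (a z) (d z)) := by
  cases τ with
  | zero =>
    exact ((continuous_carry k).measurable.comp
      (((measurable_fst.comp hx).add ha).sub hd)).prodMk (measurable_snd.comp hx)
  | succ m =>
    have hp : ∀ n, Measurable fun z => pipeline (x z) (a z) n := fun n => by
      unfold pipeline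
      split_ifs
      · exact (measurable_pi_apply _).comp (measurable_snd.comp hx)
      · exact ha
    refine Measurable.prodMk (f := fun z => (nextState k (m + 1) (x z) (a z) (d z)).1)
      (g := fun z => (nextState k (m + 1) (x z) (a z) (d z)).2) ?_ ?_
    · simp_rw [nextState_fst]
      exact ((continuous_carry k).measurable.comp ((measurable_fst.comp hx).sub hd)).add (hp 0)
    · refine measurable_pi_lambda _ fun j => ?_
      have : (fun z => (nextState k (m + 1) (x z) (a z) (d z)).2 j)
          = fun z => pipeline (x z) (a z) (j + 1) := funext fun z => nextState_snd k _ _ _ j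
      rw [this]; exact hp _

lemma measurable_stateFrom {α : Type*} [MeasurableSpace α] (k : Kind) {τ : ℕ} {A : Policy τ}
    (hA : ∀ t, Measurable (A t)) {d : α → ℕ → ℝ} {x : α → State τ} (hd : Measurable d)
    (hx : Measurable x) (t : ℕ) : Measurable (fun z => stateFrom k A (d z) (x z) t) := by
  induction t with
  | zero => exact hx
  | succ t ih =>
    exact measurable_nextState k ih ((hA t).comp ih) ((measurable_pi_apply t).comp hd)

end Inventory

namespace Inventory

/-! ### Comparison in convex order -/

section Convex

lemma exists_subgradient {ψ : ℝ → ℝ} (hψ : ConvexOn ℝ Set.univ ψ) (x : ℝ) :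
    ∃ s : ℝ, ∀ y, s * (y - x) ≤ ψ y - ψ x := by
  have hx : x ∈ interior (Set.univ : Set ℝ) := by simp
  refine ⟨derivWithin ψ (Set.Ioi x) x, fun y => ?_⟩
  rcases lt_trichotomy y x with hyx | rfl | hxy
  · have h1 := hψ.slope_le_leftDeriv_of_mem_interior (Set.mem_univ y) hx hyx
    have h2 := h1.trans (hψ.leftDeriv_le_rightDeriv_of_mem_interior hx)
    rw [slope_def_field, div_le_iff₀ (by linarith)] at h2
    linarith
  · simp
  · have h1 := hψ.rightDeriv_le_slope_of_mem_interior hx (Set.mem_univ y) hxy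
    rwa [slope_def_field, le_div_iff₀ (by linarith)] at h1

/-- Away from `x`, a convex function grows at least as fast as its support line at `x`. -/
lemma mul_sub_le_of_subgradient {ψ : ℝ → ℝ} (hψ : ConvexOn ℝ Set.univ ψ) {x s : ℝ}
    (hs : ∀ y, s * (y - x) ≤ ψ y - ψ x) {y z : ℝ}
    (h : (x ≤ y ∧ y ≤ z) ∨ (z ≤ y ∧ y ≤ x)) : s * (z - y) ≤ ψ z - ψ y := by
  rcases h with ⟨hxy, hyz⟩ | ⟨hzy, hyx⟩
  · rcases hxy.eq_or_lt with rfl | hxy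
    · exact hs z
    rcases hyz.eq_or_lt with rfl | hyz
    · simp
    have h1 := hψ.slope_mono_adjacent (Set.mem_univ x) (Set.mem_univ z) hxy hyz
    have h2 : s ≤ (ψ y - ψ x) / (y - x) := by
      rw [le_div_iff₀ (by linarith)]; exact hs y
    have := h2.trans h1
    rwa [le_div_iff₀ (by linarith)] at this
  · rcases hyx.eq_or_lt with rfl | hyx
    · exact hs z
    rcases hzy.eq_or_lt with rfl | hzy
    · simp
    have h1 := hψ.slope_mono_adjacent (Set.mem_univ z) (Set.mem_univ x) hzy hyx
    have h2 : (ψ x - ψ y) / (x - y) ≤ s := by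
      rw [div_le_iff₀ (by linarith)]; linarith [hs y]
    have := h1.trans h2
    rw [div_le_iff₀ (by linarith)] at this
    linarith

/-- Together the two hypotheses say that `g` falls at rate at most one. -/
lemma continuous_of_antitone_of_monotone_add {g : ℝ → ℝ} (hg : Antitone g)
    (hg' : Monotone fun x => g x + x) : Continuous g := by
  refine LipschitzWith.continuous (K := 1) (LipschitzWith.of_le_add fun x y => ?_)
  rw [Real.dist_eq]
  rcases le_total x y with hxy | hxy
  · have := hg' hxy
    simp only at this
    rw [abs_of_nonpos (by linarith)]; linarith
  · have := hg hxy
    linarith [abs_nonneg (x - y)]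

/-- A decreasing 1-Lipschitz function `g X` is smaller in convex order than `c - X`, if the means
are the same. -/
lemma integral_comp_le_of_antitone {Ω : Type*} [MeasurableSpace Ω] {P : Measure Ω}
    [IsProbabilityMeasure P] {X : Ω → ℝ} {ψ g : ℝ → ℝ} {c : ℝ} (hψ : ConvexOn ℝ Set.univ ψ)
    (hg : Antitone g) (hg' : Monotone fun x => g x + x) (hX : Integrable X P)
    (hgX : Integrable (fun ω => g (X ω)) P) (hψg : Integrable (fun ω => ψ (g (X ω))) P)
    (hψX : Integrable (fun ω => ψ (c - X ω)) P)
    (hmean : ∫ ω, g (X ω) ∂P = c - ∫ ω, X ω ∂P) :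
    ∫ ω, ψ (g (X ω)) ∂P ≤ ∫ ω, ψ (c - X ω) ∂P := by
  set u : ℝ → ℝ := fun x => c - x - g x with hu
  have huX : Integrable (fun ω => u (X ω)) P := ((integrable_const c).sub hX).sub hgX
  have hu0 : ∫ ω, u (X ω) ∂P = 0 := by
    simp only [hu]
    have h0 : Integrable (fun ω => c - X ω) P := (integrable_const c).sub hX
    rw [integral_sub h0 hgX, integral_sub (integrable_const c) hX, hmean]
    simp
  have hua : Antitone u := fun x y hxy => by
    have := hg' hxy
    simp only [hu] at this ⊢
    linarith
  have huc : Continuous u :=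
    (continuous_const.sub continuous_id).sub (continuous_of_antitone_of_monotone_add hg hg')
  -- A continuous function of mean zero takes values of both signs, so `u` has a zero `x`, where `c
  -- - x` and `g x` cross.
  obtain ⟨ω₁, h1⟩ := exists_le_integral huX
  obtain ⟨ω₂, h2⟩ := exists_integral_le huX
  rw [hu0] at h1 h2
  obtain ⟨x, hx⟩ := mem_range_of_exists_le_of_exists_ge huc ⟨_, h1⟩ ⟨_, h2⟩
  -- Since `u` and `g` are antitone, `g (X ω)` lies between `g x` and `c - X ω` on either side of
  -- the crossing. One slope `s` thus bounds the increment of `ψ` for all `ω`, and `s * u`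
  -- integrates to zero.
  obtain ⟨s, hs⟩ := exists_subgradient hψ (g x)
  have key : ∀ ω, s * u (X ω) ≤ ψ (c - X ω) - ψ (g (X ω)) := by
    intro ω
    have h3 : s * ((c - X ω) - g (X ω)) ≤ ψ (c - X ω) - ψ (g (X ω)) := by
      refine mul_sub_le_of_subgradient hψ hs ?_
      rcases le_total (X ω) x with h | h
      · have := hua h
        rw [hx] at this
        simp only [hu] at this
        exact Or.inl ⟨hg h, by linarith⟩
      · have := hua h
        rw [hx] at this
        simp only [hu] at this
        exact Or.inr ⟨by linarith, hg h⟩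
    exact h3
  have h4 := integral_mono (huX.const_mul s) (hψX.sub hψg) key
  rw [integral_const_mul, hu0, mul_zero] at h4
  simp only [Pi.sub_apply] at h4
  rw [integral_sub hψX hψg] at h4
  linarith

end Convex

/-! ### Independence of past and future demands -/

/-- Independent and identically distributed non-negative demands of finite mean. -/
structure IsDemand {Ω : Type*} [MeasurableSpace Ω] (P : Measure Ω) (D : ℕ → Ω → ℝ) : Prop where
  measurable : ∀ t, Measurable (D t)
  indep : iIndepFun D P
  ident : ∀ t, IdentDistrib (D t) (D 0) P P
  nonneg : ∀ t, ∀ᵐ ω ∂P, 0 ≤ D t ω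
  integrable_zero : Integrable (D 0) P

namespace IsDemand

variable {Ω : Type*} [MeasurableSpace Ω] {P : Measure Ω} {D : ℕ → Ω → ℝ}

lemma integrable (hD : IsDemand P D) (t : ℕ) : Integrable (D t) P :=
  (hD.ident t).integrable_iff.2 hD.integrable_zero

lemma integral_eq (hD : IsDemand P D) (t : ℕ) : ∫ ω, D t ω ∂P = ∫ ω, D 0 ω ∂P :=
  (hD.ident t).integral_eq

lemma integral_sum (hD : IsDemand P D) (n : ℕ) :
    ∫ ω, ∑ i ∈ Finset.range n, D i ω ∂P = n * ∫ ω, D 0 ω ∂P := by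
  rw [integral_finsetSum _ fun i _ => hD.integrable i]
  simp [hD.integral_eq]

lemma measurable_seq (hD : IsDemand P D) : Measurable (fun ω i => D i ω) :=
  measurable_pi_lambda _ hD.measurable

lemma measurable_shift (hD : IsDemand P D) (t : ℕ) : Measurable (fun ω i => D (t + i) ω) :=
  measurable_pi_lambda _ fun i => hD.measurable (t + i)

/-- Both sides are the infinite product of the common marginal law. -/
lemma map_shift (hD : IsDemand P D) (t : ℕ) :
    P.map (fun ω i => D (t + i) ω) = P.map (fun ω i => D i ω) := by
  have h1 : iIndepFun (fun i => D (t + i)) P :=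
    hD.indep.precomp (add_right_injective t)
  rw [h1.map_fun_eq_infinitePi_map (fun i => hD.measurable (t + i)),
    hD.indep.map_fun_eq_infinitePi_map hD.measurable]
  congr 1
  funext i
  rw [(hD.ident (t + i)).map_eq, (hD.ident i).map_eq]

/-- The demands before period `t`. -/
def past (D : ℕ → Ω → ℝ) (t : ℕ) (ω : Ω) (i : ℕ) : ℝ := if i < t then D i ω else 0

lemma measurable_past (hD : IsDemand P D) (t : ℕ) : Measurable (past D t) := by
  refine measurable_pi_lambda _ fun i => ?_
  unfold past
  split_ifs
  exacts [hD.measurable i, measurable_const]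

variable [IsProbabilityMeasure P]

omit [IsProbabilityMeasure P] in
lemma indepFun_past_shift (hD : IsDemand P D) (t : ℕ) :
    IndepFun (past D t) (fun ω i => D (t + i) ω) P := by
  have h := indep_iSup_of_disjoint (fun i => (hD.measurable i).comap_le) hD.indep
    (S := {i | i < t}) (T := {i | t ≤ i})
    (Set.disjoint_left.2 fun i (hi : i < t) (hi' : t ≤ i) => by omega)
  refine indep_of_indep_of_le_left (indep_of_indep_of_le_right h ?_) ?_
  · rw [← measurable_iff_comap_le]
    refine @measurable_pi_lambda _ _ _ (_) _ _ fun i => ?_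
    have : (MeasurableSpace.comap (D (t + i)) inferInstance) ≤
        ⨆ j ∈ {i | t ≤ i}, MeasurableSpace.comap (D j) inferInstance :=
      le_iSup₂_of_le (t + i) (Nat.le_add_right t i) le_rfl
    exact (comap_measurable (D (t + i))).mono this le_rfl
  · rw [← measurable_iff_comap_le]
    refine @measurable_pi_lambda _ _ _ (_) _ _ fun i => ?_
    unfold past
    split_ifs with hi
    · have : (MeasurableSpace.comap (D i) inferInstance) ≤
          ⨆ j ∈ {i | i < t}, MeasurableSpace.comap (D j) inferInstance :=
        le_iSup₂_of_le i hi le_rfl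
      exact (comap_measurable (D i)).mono this le_rfl
    · exact measurable_const

/-- The demands before and after period `t` have the law of two independent copies. -/
lemma map_past_shift (hD : IsDemand P D) (t : ℕ) :
    P.map (fun ω => (past D t ω, fun i => D (t + i) ω)) =
      (P.prod P).map (fun z => (past D t z.1, fun i => D i z.2)) := by
  rw [(hD.indepFun_past_shift t).map_prod_eq_prod_map_map (hD.measurable_past t).aemeasurable
    (hD.measurable_shift t).aemeasurable, hD.map_shift,
    Measure.map_prod_map _ _ (hD.measurable_past t) hD.measurable_seq]
  rfl

/-- Conditioning on the past, written as an iterated integral over an independent copy of the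
demands. -/
lemma lintegral_past_shift (hD : IsDemand P D) (t : ℕ) {F : (ℕ → ℝ) × (ℕ → ℝ) → ENNReal}
    (hF : Measurable F) :
    ∫⁻ ω, F (past D t ω, fun i => D (t + i) ω) ∂P =
      ∫⁻ ω, ∫⁻ ω', F (past D t ω, fun i => D i ω') ∂P ∂P := by
  have h1 : Measurable (fun ω => (past D t ω, fun i => D (t + i) ω)) :=
    (hD.measurable_past t).prodMk (hD.measurable_shift t)
  have h2 : Measurable (fun z : Ω × Ω => (past D t z.1, fun i => D i z.2)) :=
    ((hD.measurable_past t).comp measurable_fst).prodMk (hD.measurable_seq.comp measurable_snd)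
  rw [← lintegral_map hF h1, hD.map_past_shift, lintegral_map hF h2,
    lintegral_prod (fun z : Ω × Ω => F (past D t z.1, fun i => D i z.2))
      (hF.comp h2).aemeasurable]

/-- The case `t = 1` of the splitting, for real-valued functions: of `past D 1` only the coordinate
`0` matters. -/
lemma integrable_prod (hD : IsDemand P D) {F : ℝ × (ℕ → ℝ) → ℝ} (hF : Measurable F)
    (hi : Integrable (fun ω => F (D 0 ω, fun i => D (i + 1) ω)) P) :
    Integrable (fun z : Ω × Ω => F (D 0 z.1, fun i => D i z.2)) (P.prod P) := by
  have h1 : Measurable (fun ω => (past D 1 ω, fun i => D (1 + i) ω)) :=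
    (hD.measurable_past 1).prodMk (hD.measurable_shift 1)
  have h2 : Measurable (fun z : Ω × Ω => (past D 1 z.1, fun i => D i z.2)) :=
    ((hD.measurable_past 1).comp measurable_fst).prodMk (hD.measurable_seq.comp measurable_snd)
  have hF' : Measurable (fun z : (ℕ → ℝ) × (ℕ → ℝ) => F (z.1 0, z.2)) :=
    hF.comp (((measurable_pi_apply 0).comp measurable_fst).prodMk measurable_snd)
  have h3 := (integrable_map_measure hF'.aestronglyMeasurable h1.aemeasurable).2
    (by simpa [Function.comp_def, past, add_comm] using hi)
  rw [hD.map_past_shift] at h3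
  simpa [Function.comp_def, past] using
    (integrable_map_measure hF'.aestronglyMeasurable h2.aemeasurable).1 h3

lemma integral_prod (hD : IsDemand P D) {F : ℝ × (ℕ → ℝ) → ℝ} (hF : Measurable F)
    (hi : Integrable (fun ω => F (D 0 ω, fun i => D (i + 1) ω)) P) :
    ∫ ω, F (D 0 ω, fun i => D (i + 1) ω) ∂P =
      ∫ ω, ∫ ω', F (D 0 ω, fun i => D i ω') ∂P ∂P := by
  have h1 : Measurable (fun ω => (past D 1 ω, fun i => D (1 + i) ω)) :=
    (hD.measurable_past 1).prodMk (hD.measurable_shift 1)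
  have h2 : Measurable (fun z : Ω × Ω => (past D 1 z.1, fun i => D i z.2)) :=
    ((hD.measurable_past 1).comp measurable_fst).prodMk (hD.measurable_seq.comp measurable_snd)
  have hF' : Measurable (fun z : (ℕ → ℝ) × (ℕ → ℝ) => F (z.1 0, z.2)) :=
    hF.comp (((measurable_pi_apply 0).comp measurable_fst).prodMk measurable_snd)
  rw [← MeasureTheory.integral_prod _ (hD.integrable_prod hF hi)]
  have h3 := integral_map h1.aemeasurable (hF'.aestronglyMeasurable (μ := P.map _))
  have h4 := integral_map h2.aemeasurable (hF'.aestronglyMeasurable (μ := (P.prod P).map _))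
  rw [hD.map_past_shift, h4] at h3
  simpa [past, add_comm] using h3.symm

omit [IsProbabilityMeasure P] in
lemma integral_shift (hD : IsDemand P D) (t : ℕ) {F : (ℕ → ℝ) → ℝ} (hF : Measurable F) :
    ∫ ω, F (fun i => D (t + i) ω) ∂P = ∫ ω, F (fun i => D i ω) ∂P := by
  rw [← integral_map (hD.measurable_shift t).aemeasurable hF.aestronglyMeasurable, hD.map_shift,
    integral_map hD.measurable_seq.aemeasurable hF.aestronglyMeasurable]

omit [IsProbabilityMeasure P] in
lemma measurable_levelAfter (hD : IsDemand P D) (k : Kind) (q : ℕ → ℝ) (y : ℝ) (n : ℕ) :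
    Measurable (fun ω => levelAfter k q (fun i => D i ω) y n) :=
  Inventory.measurable_levelAfter k n measurable_const hD.measurable_seq measurable_const

lemma integrable_levelAfter (hD : IsDemand P D) (k : Kind) (q : ℕ → ℝ) (y : ℝ) (n : ℕ) :
    Integrable (fun ω => levelAfter k q (fun i => D i ω) y n) P := by
  have h1 : Integrable (fun ω => |y| + ∑ i ∈ Finset.range n, (|D i ω| + |q i|)) P :=
    (integrable_const _).add (integrable_finsetSum _ fun i _ =>
      (hD.integrable i).abs.add (integrable_const _))
  exact h1.mono' (hD.measurable_levelAfter k q y n).aestronglyMeasurable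
    (ae_of_all _ fun ω => abs_levelAfter_le k q _ y n)

end IsDemand

/-! ### Expected cost at equal mean: lost sales against back-orders -/

section Cost

variable {Ω : Type*} [MeasurableSpace Ω] {P : Measure Ω} [IsProbabilityMeasure P]
  {D : ℕ → Ω → ℝ} {h p : ℝ}

omit [IsProbabilityMeasure P] in
lemma integrable_netCost (hh : 0 < h) (hp : 0 < p) {X : Ω → ℝ} (hX : Integrable X P) :
    Integrable (fun ω => netCost h p (X ω)) P := by
  refine (hX.abs.const_mul (h + p)).mono'
    ((continuous_netCost h p).comp_aestronglyMeasurable hX.1) (ae_of_all _ fun ω => ?_)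
  have := abs_netCost_sub_le hh hp (X ω) 0
  simpa [netCost] using this

/-- The expected cost of a period, if the inventory position `y` was raised to meet the demand
of the `n` previous periods and of the period itself. -/
noncomputable def positionCost (P : Measure Ω) (D : ℕ → Ω → ℝ) (h p : ℝ) (n : ℕ) (y : ℝ) : ℝ :=
  ∫ ω, netCost h p (y - ∑ i ∈ Finset.range (n + 1), D i ω) ∂P

omit [IsProbabilityMeasure P] in
lemma IsDemand.integrable_sum (hD : IsDemand P D) (n : ℕ) :
    Integrable (fun ω => ∑ i ∈ Finset.range n, D i ω) P :=
  integrable_finsetSum _ fun i _ => hD.integrable i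

lemma IsDemand.integrable_positionCost (hD : IsDemand P D) (hh : 0 < h) (hp : 0 < p) (n : ℕ)
    (y : ℝ) :
    Integrable (fun ω => netCost h p (y - ∑ i ∈ Finset.range (n + 1), D i ω)) P :=
  integrable_netCost hh hp ((integrable_const y).sub (hD.integrable_sum (n + 1)))

lemma IsDemand.convexOn_positionCost (hD : IsDemand P D) (hh : 0 < h) (hp : 0 < p) (n : ℕ) :
    ConvexOn ℝ Set.univ (positionCost P D h p n) := by
  refine ⟨convex_univ, fun x _ y _ a b ha hb hab => ?_⟩
  have hi := hD.integrable_positionCost hh hp n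
  simp only [positionCost, smul_eq_mul]
  rw [← integral_const_mul, ← integral_const_mul,
    ← integral_add ((hi x).const_mul a) ((hi y).const_mul b)]
  refine integral_mono (hi _) (((hi x).const_mul a).add ((hi y).const_mul b)) fun ω => ?_
  set w := ∑ i ∈ Finset.range (n + 1), D i ω
  have := (convexOn_netCost hh hp).2 (Set.mem_univ (x - w)) (Set.mem_univ (y - w)) ha hb hab
  simp only [smul_eq_mul] at this
  have e : a * x + b * y - w = a * (x - w) + b * (y - w) := by
    linear_combination w * hab
  rw [e]
  exact this

lemma IsDemand.abs_positionCost_sub_le (hD : IsDemand P D) (hh : 0 < h) (hp : 0 < p) (n : ℕ)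
    (x y : ℝ) :
    |positionCost P D h p n x - positionCost P D h p n y| ≤ (h + p) * |x - y| := by
  have hi := hD.integrable_positionCost hh hp n
  rw [positionCost, positionCost, ← integral_sub (hi x) (hi y)]
  refine abs_integral_le_integral_abs.trans ?_
  calc _ ≤ ∫ ω, (h + p) * |x - y| ∂P := by
        refine integral_mono ((hi x).sub (hi y)).abs (integrable_const _) fun ω => ?_
        have := abs_netCost_sub_le hh hp (x - ∑ i ∈ Finset.range (n + 1), D i ω)
          (y - ∑ i ∈ Finset.range (n + 1), D i ω)
        simpa using this
    _ = _ := by simp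

lemma IsDemand.continuous_positionCost (hD : IsDemand P D) (hh : 0 < h) (hp : 0 < p) (n : ℕ) :
    Continuous (positionCost P D h p n) := by
  refine LipschitzWith.continuous (K := ⟨h + p, by positivity⟩)
    (LipschitzWith.of_dist_le_mul fun x y => ?_)
  rw [Real.dist_eq, Real.dist_eq]
  exact hD.abs_positionCost_sub_le hh hp n x y

lemma IsDemand.integrable_positionCost_comp (hD : IsDemand P D) (hh : 0 < h) (hp : 0 < p) (n : ℕ)
    {X : Ω → ℝ} (hX : Integrable X P) : Integrable (fun ω => positionCost P D h p n (X ω)) P := by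
  have hb : Integrable (fun ω => |positionCost P D h p n 0| + (h + p) * |X ω|) P :=
    (integrable_const _).add (hX.abs.const_mul _)
  refine hb.mono' ((hD.continuous_positionCost hh hp n).comp_aestronglyMeasurable hX.1)
    (ae_of_all _ fun ω => ?_)
  have h1 := hD.abs_positionCost_sub_le hh hp n (X ω) 0
  rw [sub_zero] at h1
  have h2 := abs_sub_abs_le_abs_sub (positionCost P D h p n (X ω)) (positionCost P D h p n 0)
  rw [Real.norm_eq_abs]
  linarith

lemma IsDemand.positionCost_succ (hD : IsDemand P D) (hh : 0 < h) (hp : 0 < p) (n : ℕ) (y : ℝ) :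
    positionCost P D h p (n + 1) y = ∫ ω, positionCost P D h p n (y - D 0 ω) ∂P := by
  set F : ℝ × (ℕ → ℝ) → ℝ := fun z =>
    netCost h p (y - z.1 - ∑ i ∈ Finset.range (n + 1), z.2 i) with hF
  have hFm : Measurable F := (continuous_netCost h p).measurable.comp (by fun_prop)
  have e : ∀ ω, netCost h p (y - ∑ i ∈ Finset.range (n + 1 + 1), D i ω)
      = F (D 0 ω, fun i => D (i + 1) ω) := fun ω => by
    rw [Finset.sum_range_succ', add_comm, ← sub_sub]
  have hi := hD.integrable_positionCost hh hp (n + 1) y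
  simp_rw [e] at hi
  rw [positionCost]
  simp_rw [e]
  rw [hD.integral_prod hFm hi]
  rfl

/-- With given orders, the expected cost is at most that of a back-order system in which the net
inventory has the same mean at the start of the period. -/
lemma IsDemand.integral_netCost_levelAfter_le (hD : IsDemand P D) (hh : 0 < h) (hp : 0 < p)
    (k : Kind) (n : ℕ) (q : ℕ → ℝ) (y : ℝ) :
    ∫ ω, netCost h p (levelAfter k q (fun i => D i ω) y n - D n ω) ∂P ≤
      positionCost P D h p n
        (∫ ω, levelAfter k q (fun i => D i ω) y n ∂P + n * ∫ ω, D 0 ω ∂P) := by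
  induction n generalizing q y with
  | zero => simp [positionCost, levelAfter]
  | succ n ih =>
    set μ := ∫ ω, D 0 ω ∂P with hμ
    set q' : ℕ → ℝ := fun i => q (i + 1) with hq'
    set y' : ℝ → ℝ := fun x => k.carry (y - x) + q 0 with hy'
    have hy'm : Measurable y' :=
      ((continuous_carry k).measurable.comp (measurable_const.sub measurable_id)).add_const _
    -- The mean of the final level given that the first demand is `x`. Like the level itself, it
    -- falls with `x` at rate at most one.
    set g : ℝ → ℝ := fun x => ∫ ω, levelAfter k q' (fun i => D i ω) (y' x) n ∂P with hg
    have hgi : ∀ z, Integrable (fun ω => levelAfter k q' (fun i => D i ω) z n) P :=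
      fun z => hD.integrable_levelAfter k q' z n
    have hga : Antitone g := fun x z hxz => by
      refine integral_mono (hgi _) (hgi _) fun ω => monotone_levelAfter k q' _ n ?_
      have := monotone_carry k (sub_le_sub_left hxz y)
      simp only [hy']; linarith
    have hgm : Monotone (fun x => g x + x) := fun x z hxz => by
      have h1 : y' z ≤ y' x := by
        have := monotone_carry k (sub_le_sub_left hxz y)
        simp only [hy']; linarith
      have h2 : y' x - y' z ≤ z - x := by
        have := carry_sub_carry_le k (sub_le_sub_left hxz y)
        simp only [hy']; linarith
      have h3 : g x - g z ≤ z - x := by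
        simp only [hg]
        rw [← integral_sub (hgi _) (hgi _)]
        calc _ ≤ ∫ ω, (z - x) ∂P := by
              refine integral_mono ((hgi _).sub (hgi _)) (integrable_const _) fun ω => ?_
              exact (levelAfter_sub_le k q' _ n h1).trans h2
          _ = z - x := by simp
      simp only; linarith
    have hLm : Measurable fun z : ℝ × (ℕ → ℝ) => levelAfter k q' z.2 (y' z.1) n :=
      Inventory.measurable_levelAfter k n measurable_const measurable_snd (hy'm.comp measurable_fst)
    have eL : ∀ ω, levelAfter k q (fun i => D i ω) y (n + 1) =
        levelAfter k q' (fun i => D (i + 1) ω) (y' (D 0 ω)) n := fun ω => levelAfter_succ' ..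
    have hLi := hD.integrable_levelAfter k q y (n + 1)
    have hci := integrable_netCost hh hp (hLi.sub (hD.integrable (n + 1)))
    simp only [Pi.sub_apply] at hci
    simp_rw [eL] at hLi hci ⊢
    have hgX : Integrable (fun ω => g (D 0 ω)) P :=
      (hD.integrable_prod hLm hLi).integral_prod_left
    have hmean : ∫ ω, levelAfter k q' (fun i => D (i + 1) ω) (y' (D 0 ω)) n ∂P
        = ∫ ω, g (D 0 ω) ∂P := hD.integral_prod hLm hLi
    have hCm : Measurable fun z : ℝ × (ℕ → ℝ) =>
        netCost h p (levelAfter k q' z.2 (y' z.1) n - z.2 n) :=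
      (continuous_netCost h p).measurable.comp
        (hLm.sub ((measurable_pi_apply n).comp measurable_snd))
    rw [hmean]
    have e1 := hD.integral_prod hCm hci
    simp only at e1
    rw [e1]
    have hci' := (hD.integrable_prod hCm hci).integral_prod_left
    simp only at hci'
    -- The constant for which `c - D 0` and `g (D 0)` have the same mean.
    set c := ∫ ω, g (D 0 ω) ∂P + μ with hc
    have hconv : ConvexOn ℝ Set.univ (fun z => positionCost P D h p n (z + n * μ)) := by
      have := (hD.convexOn_positionCost hh hp n).translate_left (n * μ)
      rwa [Set.preimage_univ] at this
    -- The induction hypothesis, given `D 0`, replaces the later demands by back-ordered ones; the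
    -- convex order then does the same for `D 0`, and `positionCost_succ` merges the two.
    calc _ ≤ ∫ ω, positionCost P D h p n (g (D 0 ω) + n * μ) ∂P :=
          integral_mono hci' (hD.integrable_positionCost_comp hh hp n
            (hgX.add (integrable_const _))) fun ω => ih q' (y' (D 0 ω))
      _ ≤ ∫ ω, positionCost P D h p n (c - D 0 ω + n * μ) ∂P :=
          integral_comp_le_of_antitone (ψ := fun z => positionCost P D h p n (z + n * μ))
            hconv hga hgm (hD.integrable 0) hgX
            (hD.integrable_positionCost_comp hh hp n (hgX.add (integrable_const _)))
            (hD.integrable_positionCost_comp hh hp n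
              (((integrable_const _).sub (hD.integrable 0)).add (integrable_const _)))
            (by rw [hc]; ring)
      _ = _ := by
          rw [hD.positionCost_succ hh hp]
          congr 1; funext ω; congr 1
          rw [hc]; push_cast; ring

end Cost

end Inventory

namespace Inventory

variable {Ω : Type*} [MeasurableSpace Ω] {P : Measure Ω} [IsProbabilityMeasure P]
  {D : ℕ → Ω → ℝ} {h p : ℝ}

/-! ### The newsvendor level -/

section Newsvendor

omit [IsProbabilityMeasure P] in
lemma IsDemand.measurable_leadTimeDemand (hD : IsDemand P D) (τ : ℕ) :
    Measurable (leadTimeDemand D τ) :=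
  Finset.measurable_fun_sum _ fun i _ => hD.measurable i

lemma IsDemand.newsvendorCost_eq (hD : IsDemand P D) (τ : ℕ) (y : ℝ) :
    newsvendorCost P D τ h p y = positionCost P D h p τ y := by
  have hi : Integrable (fun ω => y - leadTimeDemand D τ ω) P :=
    (integrable_const y).sub (hD.integrable_sum (τ + 1))
  have h1 : Integrable (fun ω => max (y - leadTimeDemand D τ ω) 0) P := hi.pos_part
  have h2 : Integrable (fun ω => max (leadTimeDemand D τ ω - y) 0) P := by
    simpa using hi.neg_part
  rw [newsvendorCost, positionCost, ← integral_const_mul, ← integral_const_mul,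
    ← integral_add (h1.const_mul h) (h2.const_mul p)]
  congr 1; funext ω
  simp [netCost, leadTimeDemand]

/-- A support line of the cost: the slope at `s - w` is `h` if `w ≤ s` and `-p` otherwise. Averaged
over `w`, it becomes the newsvendor derivative. -/
lemma mul_le_netCost_sub_netCost (hh : 0 < h) (hp : 0 < p) (y s w : ℝ) :
    (y - s) * ((p + h) * (if w ≤ s then 1 else 0) - p) ≤
      netCost h p (y - w) - netCost h p (s - w) := by
  have e : netCost h p (y - w) = (h + p) * max (y - w) 0 - p * (y - w) := by
    have := max_zero_sub_max_neg_zero_eq_self (y - w)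
    unfold netCost; linear_combination -p * this
  split_ifs with hw
  · have e' : netCost h p (s - w) = h * (s - w) := by
      unfold netCost
      rw [max_eq_left (by linarith), max_eq_right (by linarith)]; ring
    rw [e, e']
    have := mul_le_mul_of_nonneg_left (le_max_left (y - w) 0) (by linarith : 0 ≤ h + p)
    linarith
  · have e' : netCost h p (s - w) = -p * (s - w) := by
      unfold netCost
      rw [max_eq_right (by linarith), max_eq_left (by linarith)]; ring
    rw [e, e']
    have := mul_nonneg (by linarith : 0 ≤ h + p) (le_max_right (y - w) 0)
    linarith

/-- The newsvendor derivative is a subgradient of the expected cost. -/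
lemma IsDemand.subgradient_positionCost (hD : IsDemand P D) (hh : 0 < h) (hp : 0 < p) (τ : ℕ)
    (y s : ℝ) :
    (y - s) * ((p + h) * P.real {ω | leadTimeDemand D τ ω ≤ s} - p) ≤
      positionCost P D h p τ y - positionCost P D h p τ s := by
  have hi := hD.integrable_positionCost hh hp τ
  have hs : MeasurableSet {ω | leadTimeDemand D τ ω ≤ s} :=
    measurableSet_le (hD.measurable_leadTimeDemand τ) measurable_const
  have h1 : Integrable (fun ω => if leadTimeDemand D τ ω ≤ s then (1 : ℝ) else 0) P :=
    (integrable_const (1 : ℝ)).indicator hs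
  have h2 : ∫ ω, (if leadTimeDemand D τ ω ≤ s then (1 : ℝ) else 0) ∂P =
      P.real {ω | leadTimeDemand D τ ω ≤ s} := integral_indicator_one hs
  have h3 : Integrable (fun ω => (p + h) * (if leadTimeDemand D τ ω ≤ s then (1 : ℝ) else 0) - p) P :=
    (h1.const_mul _).sub (integrable_const p)
  have h4 := integral_mono (h3.const_mul (y - s)) ((hi y).sub (hi s)) fun ω =>
    mul_le_netCost_sub_netCost hh hp y s (leadTimeDemand D τ ω)
  simp only [Pi.sub_apply] at h4
  rw [integral_const_mul, integral_sub (h1.const_mul _) (integrable_const p),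
    integral_const_mul, h2, integral_sub (hi y) (hi s)] at h4
  simpa [positionCost] using h4

omit [IsProbabilityMeasure P] in
lemma IsDemand.leadTimeDemand_nonneg (hD : IsDemand P D) (τ : ℕ) :
    ∀ᵐ ω ∂P, 0 ≤ leadTimeDemand D τ ω := by
  filter_upwards [ae_all_iff.2 hD.nonneg] with ω hω
  exact Finset.sum_nonneg fun i _ => hω i

lemma IsDemand.nonneg_of_le_measureReal (hD : IsDemand P D) (hh : 0 < h) (hp : 0 < p) (τ : ℕ)
    {s : ℝ} (hs : p / (p + h) ≤ P.real {ω | leadTimeDemand D τ ω ≤ s}) : 0 ≤ s := by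
  by_contra! hneg
  have h0 : P.real {ω | leadTimeDemand D τ ω ≤ s} = 0 := by
    rw [measureReal_eq_zero_iff]
    refine measure_mono_null (t := {ω | ¬ 0 ≤ leadTimeDemand D τ ω}) ?_
      (hD.leadTimeDemand_nonneg τ)
    intro ω (hω : _ ≤ s)
    exact not_le.2 (hω.trans_lt hneg)
  rw [h0] at hs
  exact absurd hs (not_le.2 (by positivity))

lemma IsDemand.exists_le_measureReal (hD : IsDemand P D) (hh : 0 < h) (hp : 0 < p) (τ : ℕ) :
    ∃ s, p / (p + h) ≤ P.real {ω | leadTimeDemand D τ ω ≤ s} := by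
  have hm := hD.measurable_leadTimeDemand τ
  have := Measure.isProbabilityMeasure_map (μ := P) hm.aemeasurable
  have hlt : p / (p + h) < 1 := by rw [div_lt_one (by linarith)]; linarith
  obtain ⟨s, hs⟩ := ((tendsto_cdf_atTop (P.map (leadTimeDemand D τ))).eventually
    (lt_mem_nhds hlt)).exists
  rw [cdf_eq_real, map_measureReal_apply hm measurableSet_Iic] at hs
  exact ⟨s, hs.le⟩

lemma IsDemand.newsvendorLevel_nonneg (hD : IsDemand P D) (hh : 0 < h) (hp : 0 < p) (τ : ℕ) :
    0 ≤ newsvendorLevel P D τ h p :=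
  Real.sInf_nonneg fun _ hs => hD.nonneg_of_le_measureReal hh hp τ hs

/-- The newsvendor level minimizes the expected cost. -/
lemma IsDemand.positionCost_newsvendorLevel_le (hD : IsDemand P D) (hh : 0 < h) (hp : 0 < p)
    (τ : ℕ) (y : ℝ) :
    positionCost P D h p τ (newsvendorLevel P D τ h p) ≤ positionCost P D h p τ y := by
  set S := newsvendorLevel P D τ h p with hS
  have hph : 0 < p + h := by linarith
  have hcont := hD.continuous_positionCost hh hp τ
  rcases lt_trichotomy y S with hy | hy | hy
  -- A point `s` strictly between `y` and `S` is below the infimum, so its subgradient is negative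
  -- and its cost at most that of `y`. Continuity carries this to `S`; the other side is symmetric.
  · have hlim : Tendsto (positionCost P D h p τ) (nhdsWithin S (Set.Iio S))
        (nhds (positionCost P D h p τ S)) := (hcont.tendsto S).mono_left nhdsWithin_le_nhds
    refine le_of_tendsto hlim ?_
    filter_upwards [Ioo_mem_nhdsLT hy] with s hs
    have h1 : P.real {ω | leadTimeDemand D τ ω ≤ s} < p / (p + h) := by
      by_contra! hc
      exact absurd (csInf_le ⟨0, fun _ hr => hD.nonneg_of_le_measureReal hh hp τ hr⟩ hc)
        (not_le.2 hs.2)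
    rw [lt_div_iff₀ hph] at h1
    have h2 := hD.subgradient_positionCost hh hp τ y s
    have h3 := mul_nonneg_of_nonpos_of_nonpos (by linarith [hs.1] : y - s ≤ 0)
      (by linarith : (p + h) * P.real {ω | leadTimeDemand D τ ω ≤ s} - p ≤ 0)
    linarith
  · rw [hy]
  · have hlim : Tendsto (positionCost P D h p τ) (nhdsWithin S (Set.Ioi S))
        (nhds (positionCost P D h p τ S)) := (hcont.tendsto S).mono_left nhdsWithin_le_nhds
    refine le_of_tendsto hlim ?_
    filter_upwards [Ioo_mem_nhdsGT hy] with s hs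
    have h1 : p / (p + h) ≤ P.real {ω | leadTimeDemand D τ ω ≤ s} := by
      obtain ⟨r, hr, hrs⟩ := exists_lt_of_csInf_lt (hD.exists_le_measureReal hh hp τ) hs.1
      exact le_trans hr (measureReal_mono fun ω (hω : _ ≤ r) => hω.trans hrs.le)
    rw [div_le_iff₀ hph] at h1
    have h2 := hD.subgradient_positionCost hh hp τ y s
    have h3 := mul_nonneg (by linarith [hs.2] : 0 ≤ y - s)
      (by linarith : 0 ≤ (p + h) * P.real {ω | leadTimeDemand D τ ω ≤ s} - p)
    linarith

/-- Integrates the line `-p z` below the cost; needed when `S < τ μ`. -/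
lemma IsDemand.neg_mul_le_positionCost (hD : IsDemand P D) (hh : 0 < h) (hp : 0 < p) (n : ℕ)
    (y : ℝ) : p * ((n + 1) * ∫ ω, D 0 ω ∂P - y) ≤ positionCost P D h p n y := by
  have hi : Integrable (fun ω => y - ∑ i ∈ Finset.range (n + 1), D i ω) P :=
    (integrable_const y).sub (hD.integrable_sum (n + 1))
  have h1 := integral_mono (hi.const_mul (-p)) (hD.integrable_positionCost hh hp n y)
    fun ω => neg_mul_le_netCost hh hp _
  rw [integral_const_mul, integral_sub (integrable_const y) (hD.integrable_sum (n + 1)),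
    hD.integral_sum] at h1
  simp only [integral_const, probReal_univ, one_smul, Nat.cast_add, Nat.cast_one] at h1
  rw [positionCost]
  linarith

end Newsvendor

/-! ### From period costs to cost-rates -/

section CostRate

/-- The cost of period `t + τ` in terms of the state of period `t` and of demands independent
of it. -/
lemma IsDemand.lintegral_periodCost (hD : IsDemand P D) (k : Kind) {τ : ℕ} {A : Policy τ}
    (hA : ∀ t, Measurable (A t)) (t : ℕ) :
    ∫⁻ ω, ENNReal.ofReal (periodCost k h p A (fun i => D i ω) (t + τ)) ∂P =
      ∫⁻ ω, ∫⁻ ω', ENNReal.ofReal (netCost h p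
        (leadLevel k (stateFrom k A (fun i => D i ω) 0 t)
          (A t (stateFrom k A (fun i => D i ω) 0 t)) (fun i => D i ω') - D τ ω')) ∂P ∂P := by
  have hs : Measurable fun z : (ℕ → ℝ) × (ℕ → ℝ) => stateFrom k A z.1 0 t :=
    measurable_stateFrom k hA measurable_fst measurable_const t
  have hF : Measurable fun z : (ℕ → ℝ) × (ℕ → ℝ) => ENNReal.ofReal (netCost h p
      (leadLevel k (stateFrom k A z.1 0 t) (A t (stateFrom k A z.1 0 t)) z.2 - z.2 τ)) :=
    ((continuous_netCost h p).measurable.comp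
      ((measurable_leadLevel k hs ((hA t).comp hs) measurable_snd).sub
        ((measurable_pi_apply τ).comp measurable_snd))).ennreal_ofReal
  have hpast : ∀ ω, stateFrom k A (fun i => D i ω) 0 t =
      stateFrom k A (IsDemand.past D t ω) 0 t := fun ω =>
    stateFrom_congr k A 0 t fun i hi => by simp [IsDemand.past, hi]
  simp_rw [periodCost_eq_netCost, inventoryLevel_eq_leadLevel, hpast]
  exact hD.lintegral_past_shift t hF

omit [IsProbabilityMeasure P] in
lemma IsDemand.measurable_periodCost (hD : IsDemand P D) (k : Kind) {τ : ℕ} {A : Policy τ}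
    (hA : ∀ t, Measurable (A t)) (t : ℕ) :
    Measurable fun ω => periodCost k h p A (fun i => D i ω) t := by
  have hs := measurable_stateFrom k hA hD.measurable_seq (measurable_const (a := (0 : State τ))) t
  have hl : Measurable fun ω => inventoryLevel k A (fun i => D i ω) t := by
    cases τ with
    | zero => exact (measurable_fst.comp hs).add ((hA t).comp hs)
    | succ m => exact measurable_fst.comp hs
  simp_rw [periodCost_eq_netCost]
  exact (continuous_netCost h p).measurable.comp (hl.sub (hD.measurable t))

lemma ofReal_inv_mul_card {τ T : ℕ} (hT : τ ≤ T) :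
    ENNReal.ofReal (1 / ((T : ℝ) - τ + 1)) * ((Finset.Icc τ T).card : ENNReal) = 1 := by
  have h1 : (0 : ℝ) < T - τ + 1 := by
    have : (τ : ℝ) ≤ T := by exact_mod_cast hT
    linarith
  have h2 : ((Finset.Icc τ T).card : ℝ) = T - τ + 1 := by
    rw [Nat.card_Icc, Nat.cast_sub (by omega)]; push_cast; ring
  rw [← ENNReal.ofReal_natCast, h2, ← ENNReal.ofReal_mul (by positivity),
    one_div_mul_cancel h1.ne', ENNReal.ofReal_one]

omit [IsProbabilityMeasure P] in
lemma IsDemand.lintegral_average (hD : IsDemand P D) (hh : 0 < h) (hp : 0 < p) (k : Kind) {τ : ℕ}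
    {A : Policy τ} (hA : ∀ t, Measurable (A t)) {T : ℕ} (hT : τ ≤ T) :
    ∫⁻ ω, ENNReal.ofReal (1 / ((T : ℝ) - τ + 1) *
        ∑ t ∈ Finset.Icc τ T, periodCost k h p A (fun i => D i ω) t) ∂P =
      ENNReal.ofReal (1 / ((T : ℝ) - τ + 1)) * ∑ t ∈ Finset.Icc τ T,
        ∫⁻ ω, ENNReal.ofReal (periodCost k h p A (fun i => D i ω) t) ∂P := by
  have h1 : (0 : ℝ) ≤ 1 / (T - τ + 1) := by
    have : (τ : ℝ) ≤ T := by exact_mod_cast hT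
    exact one_div_nonneg.2 (by linarith)
  have hm := fun t => (hD.measurable_periodCost (h := h) (p := p) k hA t).ennreal_ofReal
  rw [← lintegral_finsetSum _ fun t _ => hm t,
    ← lintegral_const_mul _ (Finset.measurable_fun_sum _ fun t _ => hm t)]
  congr 1; funext ω
  rw [ENNReal.ofReal_mul h1, ENNReal.ofReal_sum_of_nonneg fun t _ => ?_]
  rw [periodCost_eq_netCost]
  exact netCost_nonneg hh hp _

omit [IsProbabilityMeasure P] in
lemma IsDemand.costRate_le (hD : IsDemand P D) (hh : 0 < h) (hp : 0 < p) (k : Kind) {τ : ℕ}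
    {A : Policy τ} (hA : ∀ t, Measurable (A t)) {g : ENNReal}
    (hg : ∀ t, ∫⁻ ω, ENNReal.ofReal (periodCost k h p A (fun i => D i ω) (t + τ)) ∂P ≤ g) :
    costRate P D k h p A ≤ g := by
  refine limsup_le_of_le (by isBoundedDefault) ?_
  filter_upwards [eventually_ge_atTop τ] with T hT
  rw [hD.lintegral_average hh hp k hA hT]
  calc _ ≤ ENNReal.ofReal (1 / ((T : ℝ) - τ + 1)) * ∑ t ∈ Finset.Icc τ T, g := by
        gcongr with t ht
        -- The average starts at period `τ`, so only periods of the form `s + τ` enter.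
        obtain ⟨s, rfl⟩ := Nat.exists_eq_add_of_le' (Finset.mem_Icc.1 ht).1
        exact hg s
    _ = g := by rw [Finset.sum_const, nsmul_eq_mul, ← mul_assoc, ofReal_inv_mul_card hT, one_mul]

omit [IsProbabilityMeasure P] in
lemma IsDemand.le_costRate (hD : IsDemand P D) (hh : 0 < h) (hp : 0 < p) (k : Kind) {τ : ℕ}
    {A : Policy τ} (hA : ∀ t, Measurable (A t)) {g : ENNReal}
    (hg : ∀ t, g ≤ ∫⁻ ω, ENNReal.ofReal (periodCost k h p A (fun i => D i ω) (t + τ)) ∂P) :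
    g ≤ costRate P D k h p A := by
  refine le_limsup_of_frequently_le (Eventually.frequently ?_) (by isBoundedDefault)
  filter_upwards [eventually_ge_atTop τ] with T hT
  rw [hD.lintegral_average hh hp k hA hT]
  calc g = ENNReal.ofReal (1 / ((T : ℝ) - τ + 1)) * ∑ t ∈ Finset.Icc τ T, g := by
        rw [Finset.sum_const, nsmul_eq_mul, ← mul_assoc, ofReal_inv_mul_card hT, one_mul]
    _ ≤ _ := by
        gcongr with t ht
        obtain ⟨s, rfl⟩ := Nat.exists_eq_add_of_le' (Finset.mem_Icc.1 ht).1
        exact hg s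

end CostRate

/-! ### Projected inventory -/

section Projection

lemma IsDemand.integrable_leadLevel (hD : IsDemand P D) (k : Kind) {τ : ℕ} (x : State τ) (a : ℝ) :
    Integrable (fun ω => leadLevel k x a (fun i => D i ω)) P :=
  hD.integrable_levelAfter k _ _ τ

omit [IsProbabilityMeasure P] in
lemma IsDemand.projectedInventory_eq (hD : IsDemand P D) (k : Kind) (τ t : ℕ) (x : State τ) :
    projectedInventory P D k τ t x = ∫ ω, leadLevel k x 0 (fun i => D i ω) ∂P := by
  simp_rw [projectedInventory, stateFrom_zero_orders]
  exact hD.integral_shift t (F := fun d => leadLevel k x 0 d)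
    (measurable_leadLevel k measurable_const measurable_const measurable_id)

lemma IsDemand.integral_leadLevel (hD : IsDemand P D) (k : Kind) {τ : ℕ} (t : ℕ) (x : State τ)
    (a : ℝ) :
    ∫ ω, leadLevel k x a (fun i => D i ω) ∂P = projectedInventory P D k τ t x + a := by
  rw [hD.projectedInventory_eq]
  simp_rw [leadLevel_eq_add k x a]
  rw [integral_add (hD.integrable_leadLevel k x 0) (integrable_const a)]
  simp

lemma IsDemand.admissible_pilPolicy (hD : IsDemand P D) (k : Kind) (τ : ℕ) (U : ℝ) :
    (pilPolicy P D k τ U).Admissible := by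
  refine fun t => ⟨?_, fun x => le_max_right _ _⟩
  have h1 : Measurable fun z : State τ × Ω => leadLevel k z.1 0 (fun i => D i z.2) :=
    measurable_leadLevel k measurable_fst measurable_const (hD.measurable_seq.comp measurable_snd)
  have h2 : Measurable (projectedInventory P D k τ t) := by
    rw [funext (hD.projectedInventory_eq k τ t)]
    exact h1.stronglyMeasurable.integral_prod_right.measurable
  exact (measurable_const.sub h2).max measurable_const

end Projection

/-! ### Optimality in the back-order system -/

section BackOrder

lemma IsDemand.baseStockPolicy_eq_pilPolicy (hD : IsDemand P D) (τ : ℕ) (S : ℝ) :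
    baseStockPolicy τ S = pilPolicy P D .backOrder τ (S - τ * ∫ ω, D 0 ω ∂P) := by
  funext t x
  rw [baseStockPolicy, pilPolicy, hD.projectedInventory_eq]
  simp_rw [leadLevel_backOrder]
  rw [integral_sub (integrable_const _) (hD.integrable_sum τ), hD.integral_sum]
  simp [inventoryPosition]

lemma IsDemand.lintegral_netCost_backOrder (hD : IsDemand P D) (hh : 0 < h) (hp : 0 < p) {τ : ℕ}
    (x : State τ) (a : ℝ) :
    ∫⁻ ω, ENNReal.ofReal (netCost h p (leadLevel .backOrder x a (fun i => D i ω) - D τ ω)) ∂P =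
      ENNReal.ofReal (positionCost P D h p τ (inventoryPosition x + a)) := by
  rw [positionCost, ofReal_integral_eq_lintegral_ofReal (hD.integrable_positionCost hh hp τ _)
    (ae_of_all _ fun ω => netCost_nonneg hh hp _)]
  congr 1; funext ω
  rw [leadLevel_backOrder, Finset.sum_range_succ, sub_sub]

/-- The position starts at `0 ≤ S` and demand only lowers it, so the positive part in the order is
never active. -/
lemma inventoryPosition_add_baseStockPolicy {τ : ℕ} {S : ℝ} (hS : 0 ≤ S) {d : ℕ → ℝ}
    (hd : ∀ i, 0 ≤ d i) (t : ℕ) :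
    inventoryPosition (stateFrom .backOrder (baseStockPolicy τ S) d 0 t) +
      baseStockPolicy τ S t (stateFrom .backOrder (baseStockPolicy τ S) d 0 t) = S := by
  have aux : ∀ (t : ℕ) (x : State τ), inventoryPosition x ≤ S →
      inventoryPosition x + baseStockPolicy τ S t x = S := by
    intro t x hx
    simp only [inventoryPosition] at hx
    rw [inventoryPosition, baseStockPolicy, max_eq_left (by linarith)]; ring
  refine aux t _ ?_
  induction t with
  | zero => simpa [stateFrom, inventoryPosition] using hS
  | succ t ih =>
    rw [stateFrom, inventoryPosition_nextState, aux t _ ih]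
    linarith [hd t]

lemma IsDemand.costRate_baseStockPolicy_le (hD : IsDemand P D) (hh : 0 < h) (hp : 0 < p) (τ : ℕ)
    {S : ℝ} (hS : 0 ≤ S) :
    costRate P D .backOrder h p (baseStockPolicy τ S) ≤
      ENNReal.ofReal (positionCost P D h p τ S) := by
  have hA : ∀ t, Measurable (baseStockPolicy τ S t) := by
    rw [hD.baseStockPolicy_eq_pilPolicy]
    exact fun t => (hD.admissible_pilPolicy _ _ _ t).1
  refine hD.costRate_le hh hp _ hA fun t => ?_
  rw [hD.lintegral_periodCost _ hA]
  simp_rw [hD.lintegral_netCost_backOrder hh hp]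
  calc _ = ∫⁻ _, ENNReal.ofReal (positionCost P D h p τ S) ∂P := by
        refine lintegral_congr_ae ?_
        filter_upwards [ae_all_iff.2 hD.nonneg] with ω hω
        rw [inventoryPosition_add_baseStockPolicy hS hω]
    _ ≤ _ := by simp

lemma IsDemand.positionCost_le_costRate (hD : IsDemand P D) (hh : 0 < h) (hp : 0 < p) {τ : ℕ}
    {A : Policy τ} (hA : A.Admissible) :
    ENNReal.ofReal (positionCost P D h p τ (newsvendorLevel P D τ h p)) ≤
      costRate P D .backOrder h p A := by
  refine hD.le_costRate hh hp _ (fun t => (hA t).1) fun t => ?_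
  rw [hD.lintegral_periodCost _ fun t => (hA t).1]
  simp_rw [hD.lintegral_netCost_backOrder hh hp]
  calc _ = ∫⁻ _, ENNReal.ofReal (positionCost P D h p τ (newsvendorLevel P D τ h p)) ∂P := by simp
    _ ≤ _ := lintegral_mono fun ω =>
      ENNReal.ofReal_le_ofReal (hD.positionCost_newsvendorLevel_le hh hp τ _)

end BackOrder

/-! ### The PIL policy in the lost-sales system -/

section LostSales

lemma leadLevel_nonneg {τ : ℕ} {x : State τ} {a : ℝ} (hx : 0 ≤ x.1) (hq : ∀ j, 0 ≤ x.2 j)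
    (ha : 0 ≤ a) (d : ℕ → ℝ) : 0 ≤ leadLevel .lostSales x a d :=
  levelAfter_nonneg (level_nonneg hx ha) τ fun i _ => pipeline_nonneg hq ha i

lemma leadLevel_zero {τ : ℕ} {d : ℕ → ℝ} (hd : ∀ i, 0 ≤ d i) :
    leadLevel .lostSales (0 : State τ) 0 d = 0 := by
  have hy : level τ (0 : State τ) 0 = 0 := by cases τ <;> simp [level]
  have hq : ∀ i, pipeline (0 : State τ) 0 i = 0 := fun i => by simp [pipeline]
  have : ∀ n, levelAfter .lostSales (pipeline (0 : State τ) 0) d 0 n = 0 := by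
    intro n
    induction n with
    | zero => rfl
    | succ n ih => rw [levelAfter, ih, hq]; simp [Kind.carry, hd n]
  rw [leadLevel, hy, this]

/-- Along the trajectory, the projected inventory never exceeds the level of the policy. -/
lemma IsDemand.stateFrom_pilPolicy (hD : IsDemand P D) {τ : ℕ} {U : ℝ} (hU : 0 ≤ U) {d : ℕ → ℝ}
    (hd : ∀ i, 0 ≤ d i) (t : ℕ) :
    let x := stateFrom .lostSales (pilPolicy P D .lostSales τ U) d 0 t
    0 ≤ x.1 ∧ (∀ j, 0 ≤ x.2 j) ∧
      projectedInventory P D .lostSales τ t x ≤ U := by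
  induction t with
  | zero =>
    refine ⟨le_rfl, fun _ => le_rfl, ?_⟩
    rw [hD.projectedInventory_eq]
    have : ∫ ω, leadLevel .lostSales (0 : State τ) 0 (fun i => D i ω) ∂P = ∫ _, (0 : ℝ) ∂P := by
      refine integral_congr_ae ?_
      filter_upwards [ae_all_iff.2 hD.nonneg] with ω hω
      exact leadLevel_zero hω
    rw [stateFrom, this]
    simpa using hU
  | succ t ih =>
    intro x'
    set x := stateFrom .lostSales (pilPolicy P D .lostSales τ U) d 0 t with hx
    obtain ⟨h1, h2, h3⟩ := ih
    set a := pilPolicy P D .lostSales τ U t x with ha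
    have ha' : a = U - projectedInventory P D .lostSales τ t x := by
      rw [ha, pilPolicy, max_eq_left (by linarith)]
    have ha0 : 0 ≤ a := by rw [ha']; linarith
    have hx' : x' = nextState .lostSales τ x a (d t) := rfl
    obtain ⟨h4, h5⟩ := nextState_lostSales_nonneg (x := x) (a := a) (d := d t) h2 ha0
    refine ⟨hx' ▸ h4, hx' ▸ h5, ?_⟩
    rw [hD.projectedInventory_eq, hx']
    -- The order raises the mean level to exactly `U`, and the next projection is pathwise no
    -- larger.
    calc _ ≤ ∫ ω, leadLevel .lostSales x a (fun i => D i ω) ∂P :=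
          integral_mono (hD.integrable_leadLevel _ _ _) (hD.integrable_leadLevel _ _ _) fun ω =>
            leadLevel_nextState_le (level_nonneg h1 ha0) (pipeline_nonneg h2 ha0) (hd t) _
      _ = U := by rw [hD.integral_leadLevel _ t, ha']; ring

/-- Almost surely the order is `U` minus the projection without truncation, so only pairs of state
and order with mean lead level `U` have to be bounded. -/
lemma IsDemand.costRate_pilPolicy_le (hD : IsDemand P D) (hh : 0 < h) (hp : 0 < p) (τ : ℕ)
    {U g : ℝ} (hU : 0 ≤ U)
    (hg : ∀ (x : State τ) (a : ℝ), 0 ≤ x.1 → (∀ j, 0 ≤ x.2 j) → 0 ≤ a →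
      ∫ ω, leadLevel .lostSales x a (fun i => D i ω) ∂P = U →
      ∫ ω, netCost h p (leadLevel .lostSales x a (fun i => D i ω) - D τ ω) ∂P ≤ g) :
    costRate P D .lostSales h p (pilPolicy P D .lostSales τ U) ≤ ENNReal.ofReal g := by
  have hA := fun t => (hD.admissible_pilPolicy .lostSales τ U t).1
  have hi : ∀ (x : State τ) (a : ℝ), Integrable (fun ω => netCost h p
      (leadLevel .lostSales x a (fun i => D i ω) - D τ ω)) P := fun x a =>
    integrable_netCost hh hp ((hD.integrable_leadLevel .lostSales x a).sub (hD.integrable τ))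
  refine hD.costRate_le hh hp _ hA fun t => ?_
  rw [hD.lintegral_periodCost _ hA]
  calc _ ≤ ∫⁻ _, ENNReal.ofReal g ∂P := by
        refine lintegral_mono_ae ?_
        filter_upwards [ae_all_iff.2 hD.nonneg] with ω hω
        obtain ⟨h1, h2, h3⟩ := hD.stateFrom_pilPolicy (τ := τ) hU hω t
        rw [← ofReal_integral_eq_lintegral_ofReal (hi _ _)
          (ae_of_all _ fun ω => netCost_nonneg hh hp _)]
        refine ENNReal.ofReal_le_ofReal (hg _ _ h1 h2 (le_max_right _ _) ?_)
        rw [hD.integral_leadLevel _ t, pilPolicy, max_eq_left (by linarith)]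
        ring
    _ = _ := by simp

lemma IsDemand.costRate_pilPolicy_newsvendorLevel_le (hD : IsDemand P D) (hh : 0 < h)
    (hp : 0 < p) (τ : ℕ) (S : ℝ) :
    costRate P D .lostSales h p
        (pilPolicy P D .lostSales τ (max (S - τ * ∫ ω, D 0 ω ∂P) 0)) ≤
      ENNReal.ofReal (positionCost P D h p τ S) := by
  set μ := ∫ ω, D 0 ω ∂P with hμ
  refine hD.costRate_pilPolicy_le hh hp τ (le_max_right _ _) fun x a hx hq ha hU => ?_
  rcases le_total 0 (S - τ * μ) with hS | hS
  · have h1 := hD.integral_netCost_levelAfter_le hh hp .lostSales τ (pipeline x a) (level τ x a)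
    change _ ≤ positionCost P D h p τ
      (∫ ω, leadLevel .lostSales x a (fun i => D i ω) ∂P + τ * μ) at h1
    rwa [hU, max_eq_left hS, sub_add_cancel] at h1
  -- Here `U = 0`: a non-negative level of mean zero vanishes almost surely, and all demand of the
  -- period is lost.
  · rw [max_eq_right hS, integral_eq_zero_iff_of_nonneg (fun ω => leadLevel_nonneg hx hq ha _)
      (hD.integrable_leadLevel _ _ _)] at hU
    have h1 : ∫ ω, netCost h p (leadLevel .lostSales x a (fun i => D i ω) - D τ ω) ∂P =
        ∫ ω, p * D τ ω ∂P := by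
      refine integral_congr_ae ?_
      filter_upwards [hU, hD.nonneg τ] with ω h0 hω
      simp only [Pi.zero_apply] at h0
      simp [h0, netCost, hω]
    rw [h1, integral_const_mul, hD.integral_eq]
    refine le_trans ?_ (hD.neg_mul_le_positionCost hh hp τ S)
    exact mul_le_mul_of_nonneg_left (by linarith) hp.le

end LostSales

end Inventory

theorem mainTheorem1 {Ω : Type*} [MeasurableSpace Ω] (P : Measure Ω) [IsProbabilityMeasure P]
    (D : ℕ → Ω → ℝ) (hmeas : ∀ t, Measurable (D t)) (hindep : iIndepFun D P)
    (hident : ∀ t, IdentDistrib (D t) (D 0) P P) (hnonneg : ∀ t, ∀ᵐ ω ∂P, 0 ≤ D t ω)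
    (hint : Integrable (D 0) P) (τ : ℕ) (h p : ℝ) (hh : 0 < h) (hp : 0 < p)
    (μ S : ℝ) (hμ : μ = ∫ ω, D 0 ω ∂P) (hS : S = newsvendorLevel P D τ h p) :
    -- in the back-order system, the base-stock policy with level `S` is the PIL policy with
    -- level `S - τ μ`, it is optimal, and the optimal cost-rate is the newsvendor cost
    baseStockPolicy τ S = pilPolicy P D .backOrder τ (S - τ * μ) ∧
    costRate P D .backOrder h p (baseStockPolicy τ S) = optimalCostRate P D .backOrder τ h p ∧
    costRate P D .backOrder h p (pilPolicy P D .backOrder τ (S - τ * μ)) =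
      optimalCostRate P D .backOrder τ h p ∧
    optimalCostRate P D .backOrder τ h p = ENNReal.ofReal (newsvendorCost P D τ h p S) ∧
    -- the PIL policy with level `(S - τ μ)⁺` in the lost-sales system costs no more
    costRate P D .lostSales h p (pilPolicy P D .lostSales τ (max (S - τ * μ) 0)) ≤
      optimalCostRate P D .backOrder τ h p ∧
    -- the best PIL level costs no more than this level
    (∀ Ustar : ℝ, 0 ≤ Ustar →
      (∀ U : ℝ, 0 ≤ U → costRate P D .lostSales h p (pilPolicy P D .lostSales τ Ustar) ≤
        costRate P D .lostSales h p (pilPolicy P D .lostSales τ U)) →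
      optimalCostRate P D .lostSales τ h p ≤
          costRate P D .lostSales h p (pilPolicy P D .lostSales τ Ustar) ∧
        costRate P D .lostSales h p (pilPolicy P D .lostSales τ Ustar) ≤
          costRate P D .lostSales h p (pilPolicy P D .lostSales τ (max (S - τ * μ) 0))) ∧
    -- the optimal cost-rates of the two systems
    optimalCostRate P D .lostSales τ h p ≤
      costRate P D .lostSales h p (pilPolicy P D .lostSales τ (max (S - τ * μ) 0)) ∧
    optimalCostRate P D .lostSales τ h p ≤ optimalCostRate P D .backOrder τ h p := by
  have hD : IsDemand P D := ⟨hmeas, hindep, hident, hnonneg, hint⟩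
  have heq : baseStockPolicy τ S = pilPolicy P D .backOrder τ (S - τ * μ) := by
    rw [hμ]; exact hD.baseStockPolicy_eq_pilPolicy τ S
  have hadm : ∀ k U, (pilPolicy P D k τ U).Admissible := fun k U => hD.admissible_pilPolicy k τ U
  have hlow : ENNReal.ofReal (positionCost P D h p τ S) ≤
      optimalCostRate P D .backOrder τ h p :=
    le_iInf₂ fun A hA => hS ▸ hD.positionCost_le_costRate hh hp hA
  have hbase : costRate P D .backOrder h p (baseStockPolicy τ S) ≤
      ENNReal.ofReal (positionCost P D h p τ S) :=
    hD.costRate_baseStockPolicy_le hh hp τ (hS ▸ hD.newsvendorLevel_nonneg hh hp τ)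
  have hopt : optimalCostRate P D .backOrder τ h p ≤
      costRate P D .backOrder h p (baseStockPolicy τ S) := by
    rw [heq]; exact iInf₂_le _ (hadm _ _)
  have h1 : costRate P D .backOrder h p (baseStockPolicy τ S) =
      optimalCostRate P D .backOrder τ h p := le_antisymm (hbase.trans hlow) hopt
  have h2 : costRate P D .lostSales h p (pilPolicy P D .lostSales τ (max (S - τ * μ) 0)) ≤
      optimalCostRate P D .backOrder τ h p := by
    rw [hμ]; exact (hD.costRate_pilPolicy_newsvendorLevel_le hh hp τ S).trans hlow
  have h3 : ∀ U, optimalCostRate P D .lostSales τ h p ≤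
      costRate P D .lostSales h p (pilPolicy P D .lostSales τ U) := fun U =>
    iInf₂_le _ (hadm _ _)
  refine ⟨heq, h1, heq ▸ h1, ?_, h2, fun U _ hU => ⟨h3 U, hU _ (le_max_right _ _)⟩, h3 _,
    (h3 _).trans h2⟩
  rw [hD.newsvendorCost_eq]
  exact le_antisymm (hopt.trans hbase) hlow
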